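/- Let $(K,\mathcal T)$ be a compact topological space which is a Namioka--Phelps compact: that is, there is a metric $d$ on $K$ such that (i) $d$ is $\mathcal T$-lower semicontinuous, i.e. $d:K\times K\to\mathbb R$ is a lower semicontinuous function for the product topology $\mathcal T\times\mathcal T$; and (ii) property $P(d,\mathcal T)$ holds, i.e. the topology $\mathcal T_d$ induced by $d$ is finer than $\mathcal T$, and there is a sequence $(B_n)_{n\in\omega}$ of subsets of $K$ such that the topology generated by $\mathcal T\cup\{B_n:n\in\omega\}$ is finer than $\mathcal T_d$ (here "finer" allows equality). Then there is a norm $\|\cdot\|$ on the space $\mathcal C(K)$ of continuous real-valued functions on $K$ which is equivalent to the supremum norm and is locally uniformly convex (LUR): for every $f\in\mathcal C(K)$ and every sequence $(f_r)$ in $\mathcal C(K)$, if $$\tfrac12\|f\|^2+\tfrac12\|f_r\|^2-\left\|\tfrac12(f+f_r)\right\|^2\to 0,$$ then $\|f-f_r\|\to 0$. -/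

import Mathlib

open Filter Topology

/-- The topology on `K` induced by the metric `d`. -/
abbrev metricTopology {K : Type*} (d : MetricSpace K) : TopologicalSpace K :=
  d.toPseudoMetricSpace.toUniformSpace.toTopologicalSpace

/-- The metric `d` is lower semicontinuous with respect to the topology `T`, that is, `d` is a
lower semicontinuous function on the product `(K, T) × (K, T)`. -/
def IsLSCMetric {K : Type*} (T : TopologicalSpace K) (d : MetricSpace K) : Prop :=
  @LowerSemicontinuous (K × K) ℝ (@instTopologicalSpaceProd K K T T) _
    (fun q => d.dist q.1 q.2)

/-- Property `P(d, T)`: the topology of the metric `d` is finer than `T`, and there is a sequence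
`(B n)` of subsets of `K` such that the topology generated by the `T`-open sets together with the
sets `B n` is finer than the topology of `d`. (In Mathlib `T₁ ≤ T₂` means that `T₁` is finer.) -/
def PropertyP {K : Type*} (d : MetricSpace K) (T : TopologicalSpace K) : Prop :=
  metricTopology d ≤ T ∧
    ∃ B : ℕ → Set K,
      TopologicalSpace.generateFrom ({U : Set K | IsOpen[T] U} ∪ Set.range B) ≤ metricTopology d

/-- A Namioka-Phelps compact: a compact space `(K, T)` with property `P(d, T)` for some
`T`-lower semicontinuous metric `d`. Such a space is automatically Hausdorff, because its diagonal
`{(x, y) | d x y ≤ 0}` is closed. -/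
def IsNamiokaPhelpsCompact (K : Type*) [T : TopologicalSpace K] : Prop :=
  CompactSpace K ∧ ∃ d : MetricSpace K, IsLSCMetric T d ∧ PropertyP d T

section Renorming

variable {E : Type*} [NormedAddCommGroup E] [NormedSpace ℝ E]

/-- `p` is a norm on `E` equivalent to the given one (it is definite by the lower bound). -/
def IsEquivalentNorm (p : Seminorm ℝ E) : Prop :=
  ∃ a b : ℝ, 0 < a ∧ 0 < b ∧ ∀ f : E, a * ‖f‖ ≤ p f ∧ p f ≤ b * ‖f‖

/-- `p` is locally uniformly rotund at `f`. -/
def IsLURAt (p : Seminorm ℝ E) (f : E) : Prop :=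
  ∀ g : ℕ → E,
    Tendsto (fun r => (1 / 2 : ℝ) * p f ^ 2 + (1 / 2 : ℝ) * p (g r) ^ 2
      - p ((1 / 2 : ℝ) • (f + g r)) ^ 2) atTop (𝓝 0) →
    Tendsto (fun r => p (f - g r)) atTop (𝓝 0)

/-- `p` is locally uniformly rotund (locally uniformly convex). -/
def IsLUR (p : Seminorm ℝ E) : Prop :=
  ∀ f : E, IsLURAt p f

end Renorming

/-!
Write `Φ` for the square of a seminorm and `½ Φ f + ½ Φ g - Φ (½ (f + g)) ≥ 0` for its midpoint
defect. The norm constructed here is the square root of `‖f‖² + ∑ a_l sup_i χ_{l,i} f`, where `l`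
runs through a countable set and each `χ_{l,i}` is the square of a seminorm. By a form of Deville's
lemma (`tendsto_midpointDefect_of_iSup`), if `χ_{l,i}` dominates the other members of its family at
`f` by a fixed amount, then the defect of `χ_{l,i}` at `(f, g r)` tends to `0` whenever that of
the norm does (`exists_isLUR_of_strict_max`). It remains to find families in which, for each `f`
and `ε`, some such dominating `χ_{l,i}` controls `f` up to `ε`.

To control `f` it is enough to have finitely many products `V c ×ˢ V' c` of disjoint open sets that
cover the compact set `{(x, y) | |f x - f y| ≥ ε}`. Let `R` be the complement of their union. Then
the supremum of `|f x - f y|` over `R` is at most `ε`, the same holds approximately for `g r`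
because the square of this supremum is one of the terms of `χ_{l,i}`, and finitely many points
represent all points of `K` up to `R`; the values at these points form another term of `χ_{l,i}`
(`eventually_norm_sub_le`).

The products come from the metric `d`. A continuous function is uniformly continuous for `d`, since
`d` is lower semicontinuous. Property `P(d, T)` provides, for each `δ`, a cover of `K` by countably
many isolated families of sets contained in `d`-balls of radius `δ`
(`PropertyP.exists_isolatedCover`), and hence a cover of `K × K` of the same kind. Two closed
`d`-balls with distant centres are closed and disjoint, so disjoint neighbourhoods of them can be
fixed once and for all, independently of `f`. The products needed for `f` are those attached to
finitely many members of the cover.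

These members are singled out by a maximum. By compactness, every nonempty closed set `H ⊆ K × K`
meets, for one of countably many families of relatively open pieces, only finitely many pieces,
but at least one (`exists_piece_inter`, `finite_piece_inter`). So, with `H` the set where
`|f x - f y|` is large, the finitely many pieces on which the supremum of `|f x - f y|` exceeds a
threshold are the unique maximizers of a sum of squared suprema over a given number of pieces. Their
products are removed, and the procedure goes on with what is left; a weight on the earlier stages
keeps the maximum unique (`IsStrictMax.cons`). A compactness argument shows that finitely many
stages suffice (`exists_isStrictMax`).
-/

/-! ### Squares of seminorms and their midpoint defect -/

section SquareSeminorm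

variable {E : Type*} [NormedAddCommGroup E] [NormedSpace ℝ E]

/-- `Φ` is the square of a seminorm, encoded as a nonnegative, convex function which is
homogeneous of degree two. Unlike seminorms, such functions may simply be added up. -/
structure IsSqSeminorm (Φ : E → ℝ) : Prop where
  nonneg : ∀ f, 0 ≤ Φ f
  convexOn : ConvexOn ℝ Set.univ Φ
  smul : ∀ (t : ℝ) f, Φ (t • f) = t ^ 2 * Φ f

/-- The defect of midpoint convexity of `Φ` at the pair `(f, g)`. -/
noncomputable def midpointDefect (Φ : E → ℝ) (f g : E) : ℝ :=
  (1 / 2 : ℝ) * Φ f + (1 / 2 : ℝ) * Φ g - Φ ((1 / 2 : ℝ) • (f + g))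

lemma midpointDefect_add (Φ Ψ : E → ℝ) (f g : E) :
    midpointDefect (fun u => Φ u + Ψ u) f g = midpointDefect Φ f g + midpointDefect Ψ f g := by
  simp only [midpointDefect]; ring

lemma midpointDefect_const_mul (c : ℝ) (Φ : E → ℝ) (f g : E) :
    midpointDefect (fun u => c * Φ u) f g = c * midpointDefect Φ f g := by
  simp only [midpointDefect]; ring

namespace IsSqSeminorm

variable {Φ Ψ : E → ℝ}

lemma convex_le (h : IsSqSeminorm Φ) {a b : ℝ} (ha : 0 ≤ a) (hb : 0 ≤ b) (hab : a + b = 1)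
    (f g : E) : Φ (a • f + b • g) ≤ a * Φ f + b * Φ g :=
  h.convexOn.2 (Set.mem_univ f) (Set.mem_univ g) ha hb hab

lemma midpoint_le (h : IsSqSeminorm Φ) (f g : E) :
    Φ ((1 / 2 : ℝ) • (f + g)) ≤ (1 / 2 : ℝ) * Φ f + (1 / 2 : ℝ) * Φ g := by
  rw [smul_add]
  exact h.convex_le (by norm_num) (by norm_num) (by norm_num) f g

lemma midpointDefect_nonneg (h : IsSqSeminorm Φ) (f g : E) : 0 ≤ midpointDefect Φ f g := by
  have := h.midpoint_le f g
  unfold midpointDefect; linarith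

lemma zero : IsSqSeminorm (fun _ : E => (0 : ℝ)) :=
  ⟨fun _ => le_rfl, convexOn_const 0 convex_univ, by simp⟩

lemma add (h : IsSqSeminorm Φ) (h' : IsSqSeminorm Ψ) : IsSqSeminorm (fun f => Φ f + Ψ f) :=
  ⟨fun f => add_nonneg (h.nonneg f) (h'.nonneg f), h.convexOn.add h'.convexOn,
    fun t f => by rw [h.smul, h'.smul]; ring⟩

lemma const_mul (h : IsSqSeminorm Φ) {c : ℝ} (hc : 0 ≤ c) : IsSqSeminorm (fun f => c * Φ f) :=
  ⟨fun f => mul_nonneg hc (h.nonneg f), h.convexOn.smul hc, fun t f => by rw [h.smul]; ring⟩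

lemma sum {ι : Type*} {Φ : ι → E → ℝ} (s : Finset ι) (h : ∀ i ∈ s, IsSqSeminorm (Φ i)) :
    IsSqSeminorm (fun f => ∑ i ∈ s, Φ i f) := by
  classical
  induction s using Finset.induction_on with
  | empty => simpa using zero
  | insert a s ha ih =>
    simp only [Finset.sum_insert ha]
    exact (h a (by simp)).add (ih fun i hi => h i (by simp [hi]))

lemma iSup {ι : Type*} {Φ : ι → E → ℝ} (h : ∀ i, IsSqSeminorm (Φ i))
    (hb : ∀ f, BddAbove (Set.range fun i => Φ i f)) : IsSqSeminorm (fun f => ⨆ i, Φ i f) := by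
  refine ⟨fun f => Real.iSup_nonneg fun i => (h i).nonneg f, ⟨convex_univ, ?_⟩, fun t f => ?_⟩
  · intro f _ g _ a b ha hb' hab
    have hn : 0 ≤ a • (⨆ i, Φ i f) + b • (⨆ i, Φ i g) :=
      add_nonneg (mul_nonneg ha (Real.iSup_nonneg fun i => (h i).nonneg f))
        (mul_nonneg hb' (Real.iSup_nonneg fun i => (h i).nonneg g))
    refine Real.iSup_le (fun i => ?_) hn
    refine ((h i).convexOn.2 (Set.mem_univ f) (Set.mem_univ g) ha hb' hab).trans ?_
    exact add_le_add (mul_le_mul_of_nonneg_left (le_ciSup (hb f) i) ha)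
      (mul_le_mul_of_nonneg_left (le_ciSup (hb g) i) hb')
  · simp only [(h _).smul]
    rw [Real.mul_iSup_of_nonneg (sq_nonneg t)]

lemma norm_sq : IsSqSeminorm (fun f : E => ‖f‖ ^ 2) :=
  ⟨fun _ => sq_nonneg _, convexOn_univ_norm.pow (fun _ _ => norm_nonneg _) 2,
    fun t f => by rw [norm_smul, mul_pow, Real.norm_eq_abs, sq_abs]⟩

lemma linear_sq (L : E →ₗ[ℝ] ℝ) : IsSqSeminorm (fun f => L f ^ 2) :=
  ⟨fun _ => sq_nonneg _,
    ((even_two.convexOn_pow (𝕜 := ℝ) (n := 2)).comp_linearMap L),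
    fun t f => by rw [map_smul, smul_eq_mul, mul_pow]⟩

lemma sqrt_smul (h : IsSqSeminorm Φ) (t : ℝ) (f : E) : √(Φ (t • f)) = ‖t‖ * √(Φ f) := by
  rw [h.smul, Real.sqrt_mul (sq_nonneg t), Real.sqrt_sq_eq_abs, Real.norm_eq_abs]

lemma sqrt_add_le (h : IsSqSeminorm Φ) (f g : E) : √(Φ (f + g)) ≤ √(Φ f) + √(Φ g) := by
  refine le_of_forall_pos_le_add fun e he => ?_
  set a := √(Φ f) + e / 2 with ha
  set b := √(Φ g) + e / 2 with hb
  have ha0 : 0 < a := by positivity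
  have hb0 : 0 < b := by positivity
  have hf : Φ f ≤ a ^ 2 := by
    rw [← Real.sqrt_le_left ha0.le]; linarith
  have hg : Φ g ≤ b ^ 2 := by
    rw [← Real.sqrt_le_left hb0.le]; linarith
  have key := h.convex_le (a := a / (a + b)) (b := b / (a + b)) (by positivity) (by positivity)
    (by field_simp) (a⁻¹ • f) (b⁻¹ • g)
  rw [smul_smul, smul_smul, h.smul, h.smul] at key
  have e1 : a / (a + b) * a⁻¹ = (a + b)⁻¹ := by field_simp
  have e2 : b / (a + b) * b⁻¹ = (a + b)⁻¹ := by field_simp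
  rw [e1, e2, ← smul_add, h.smul] at key
  have k1 : a⁻¹ ^ 2 * Φ f ≤ 1 := by
    rw [inv_pow, inv_mul_le_iff₀ (by positivity)]; linarith
  have k2 : b⁻¹ ^ 2 * Φ g ≤ 1 := by
    rw [inv_pow, inv_mul_le_iff₀ (by positivity)]; linarith
  have k3 : (a + b)⁻¹ ^ 2 * Φ (f + g) ≤ 1 := by
    calc _ ≤ _ := key
      _ ≤ a / (a + b) * 1 + b / (a + b) * 1 := by gcongr
      _ = 1 := by field_simp
  rw [inv_pow, inv_mul_le_iff₀ (by positivity), mul_one] at k3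
  calc √(Φ (f + g)) ≤ a + b := (Real.sqrt_le_left (by positivity)).2 k3
    _ = _ := by rw [ha, hb]; ring

/-- The seminorm whose square is `Φ`. -/
noncomputable def toSeminorm (h : IsSqSeminorm Φ) : Seminorm ℝ E :=
  Seminorm.of (fun f => √(Φ f)) h.sqrt_add_le h.sqrt_smul

lemma toSeminorm_apply (h : IsSqSeminorm Φ) (f : E) : h.toSeminorm f = √(Φ f) := rfl

lemma toSeminorm_sq (h : IsSqSeminorm Φ) (f : E) : h.toSeminorm f ^ 2 = Φ f :=
  Real.sq_sqrt (h.nonneg f)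

lemma sq_sqrt_sub_sqrt_le (h : IsSqSeminorm Φ) (f g : E) :
    (√(Φ f) - √(Φ g)) ^ 2 ≤ 4 * midpointDefect Φ f g := by
  have h1 : √(Φ ((1 / 2 : ℝ) • (f + g))) ≤ (1 / 2 : ℝ) * (√(Φ f) + √(Φ g)) := by
    rw [h.sqrt_smul]
    have := h.sqrt_add_le f g
    norm_num at this ⊢; linarith
  have h2 : Φ ((1 / 2 : ℝ) • (f + g)) ≤ ((1 / 2 : ℝ) * (√(Φ f) + √(Φ g))) ^ 2 :=
    (Real.sqrt_le_left (by positivity)).1 h1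
  have h3 := Real.sq_sqrt (h.nonneg f)
  have h4 := Real.sq_sqrt (h.nonneg g)
  unfold midpointDefect
  nlinarith

/-- A vanishing midpoint defect forces convergence of the values. -/
lemma tendsto_sqrt (h : IsSqSeminorm Φ) {f : E} {g : ℕ → E}
    (hg : Tendsto (fun r => midpointDefect Φ f (g r)) atTop (𝓝 0)) :
    Tendsto (fun r => √(Φ (g r))) atTop (𝓝 √(Φ f)) := by
  have h1 : Tendsto (fun r => (√(Φ f) - √(Φ (g r))) ^ 2) atTop (𝓝 0) :=
    squeeze_zero (fun _ => sq_nonneg _) (fun r => h.sq_sqrt_sub_sqrt_le f (g r))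
      (by simpa using hg.const_mul 4)
  have h2 : Tendsto (fun r => |√(Φ f) - √(Φ (g r))|) atTop (𝓝 0) := by
    simpa [Real.sqrt_sq_eq_abs] using h1.sqrt
  have h3 := (tendsto_zero_iff_abs_tendsto_zero _).2 h2
  simpa using h3.const_sub √(Φ f)

end IsSqSeminorm

/-- A summand of a sum of squares of seminorms inherits a vanishing midpoint defect. -/
lemma tendsto_midpointDefect_of_le {Φ Ψ : E → ℝ} (hΦ : IsSqSeminorm Φ) {c : ℝ} (hc : 0 < c)
    {f : E} {g : ℕ → E} (hle : ∀ r, c * midpointDefect Φ f (g r) ≤ midpointDefect Ψ f (g r))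
    (hg : Tendsto (fun r => midpointDefect Ψ f (g r)) atTop (𝓝 0)) :
    Tendsto (fun r => midpointDefect Φ f (g r)) atTop (𝓝 0) := by
  refine squeeze_zero (fun r => hΦ.midpointDefect_nonneg _ _)
    (fun r => ?_) (by simpa using hg.const_mul c⁻¹)
  rw [← div_eq_inv_mul, le_div_iff₀ hc]
  linarith [hle r]

/-! ### Renorming by suprema with a strict maximum -/

/-- If the supremum `⨆ i, χ i` at `f` is attained at `i₀`, and the other values stay below it by a
fixed amount, then a vanishing midpoint defect at `f` passes from the supremum to `χ i₀`. This is
a form of Deville's lemma. -/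
lemma tendsto_midpointDefect_of_iSup {ι : Type*} {χ : ι → E → ℝ} (h : ∀ i, IsSqSeminorm (χ i))
    (hb : ∀ f, BddAbove (Set.range fun i => χ i f)) {f : E} {g : ℕ → E} {i₀ : ι} {η : ℝ}
    (hη : 0 < η) (hi₀ : ∀ i, i ≠ i₀ → χ i f + η ≤ χ i₀ f)
    (hg : Tendsto (fun r => midpointDefect (fun u => ⨆ i, χ i u) f (g r)) atTop (𝓝 0)) :
    Tendsto (fun r => midpointDefect (χ i₀) f (g r)) atTop (𝓝 0) := by
  have hev := hg.eventually (gt_mem_nhds (show (0 : ℝ) < η / 4 by positivity))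
  refine squeeze_zero' (Eventually.of_forall fun r => (h i₀).midpointDefect_nonneg _ _) ?_ hg
  filter_upwards [hev] with r hr
  refine le_of_forall_pos_le_add fun τ hτ => ?_
  have : Nonempty ι := ⟨i₀⟩
  obtain ⟨i, hi⟩ := exists_lt_of_lt_ciSup
    (show (⨆ i, χ i ((1 / 2 : ℝ) • (f + g r))) - min τ (η / 4)
      < ⨆ i, χ i ((1 / 2 : ℝ) • (f + g r)) by
      have : 0 < min τ (η / 4) := by positivity
      linarith)
  have hτ1 := min_le_left τ (η / 4)
  have hτ2 := min_le_right τ (η / 4)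
  have hf : χ i₀ f ≤ ⨆ i, χ i f := le_ciSup (hb f) i₀
  have hgi : χ i (g r) ≤ ⨆ i, χ i (g r) := le_ciSup (hb (g r)) i
  by_cases hii : i = i₀
  · subst hii
    simp only [midpointDefect] at hr ⊢
    linarith
  · have h1 := hi₀ i hii
    have h2 := (h i).midpointDefect_nonneg f (g r)
    simp only [midpointDefect] at hr h2
    linarith

/-- The renorming principle: countably many pointwise bounded families `χ l` of squares of
seminorms yield a locally uniformly rotund norm as soon as convergence `g r → f` can be read off
from those `χ l i` that dominate their family at `f` by a fixed amount. -/
theorem exists_isLUR_of_strict_max {Λ : Type*} [Countable Λ] {I : Λ → Type*}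
    (χ : ∀ l, I l → E → ℝ) (B : Λ → ℝ) (hB : ∀ l, 0 ≤ B l) (hχ : ∀ l i, IsSqSeminorm (χ l i))
    (hχB : ∀ l i f, χ l i f ≤ B l * ‖f‖ ^ 2)
    (H : ∀ (f : E) (g : ℕ → E),
      (∀ l (i₀ : I l) (η : ℝ), 0 < η → (∀ i, i ≠ i₀ → χ l i f + η ≤ χ l i₀ f) →
        Tendsto (fun r => midpointDefect (χ l i₀) f (g r)) atTop (𝓝 0)) →
      Tendsto (fun r => ‖f - g r‖) atTop (𝓝 0)) :
    ∃ p : Seminorm ℝ E, IsEquivalentNorm p ∧ IsLUR p := by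
  obtain ⟨c, hc0, C, hcC, -⟩ := NNReal.exists_pos_sum_of_countable one_ne_zero Λ
  have hcs : Summable fun l => (c l : ℝ) := NNReal.summable_coe.2 hcC.summable
  have hbdd : ∀ l f, BddAbove (Set.range fun i => χ l i f) := fun l f =>
    ⟨B l * ‖f‖ ^ 2, by rintro _ ⟨i, rfl⟩; exact hχB l i f⟩
  set Θ : Λ → E → ℝ := fun l f => ⨆ i, χ l i f with hΘ
  have hΘs : ∀ l, IsSqSeminorm (Θ l) := fun l => IsSqSeminorm.iSup (hχ l) (hbdd l)
  have hΘB : ∀ l f, Θ l f ≤ B l * ‖f‖ ^ 2 := fun l f =>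
    Real.iSup_le (fun i => hχB l i f) (mul_nonneg (hB l) (sq_nonneg _))
  set a : Λ → ℝ := fun l => c l / (1 + B l) with ha
  have ha0 : ∀ l, 0 < a l := fun l => by
    have := hB l
    have := NNReal.coe_pos.2 (hc0 l)
    simp only [ha]; positivity
  have hab : ∀ l f, a l * Θ l f ≤ c l * ‖f‖ ^ 2 := fun l f => by
    have h0 := hB l
    have hc := (c l).coe_nonneg
    calc a l * Θ l f ≤ c l / (1 + B l) * (B l * ‖f‖ ^ 2) :=
          mul_le_mul_of_nonneg_left (hΘB l f) (ha0 l).le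
      _ = c l * (B l / (1 + B l)) * ‖f‖ ^ 2 := by ring
      _ ≤ c l * 1 * ‖f‖ ^ 2 := by
          gcongr
          rw [div_le_one (by positivity)]; linarith
      _ = _ := by ring
  have hsum : ∀ f, Summable fun l => a l * Θ l f := fun f =>
    Summable.of_nonneg_of_le (fun l => mul_nonneg (ha0 l).le ((hΘs l).nonneg f)) (fun l => hab l f)
      (hcs.mul_right _)
  set S : E → ℝ := fun f => ∑' l, a l * Θ l f with hS
  have hSB : ∀ f, S f ≤ (∑' l, (c l : ℝ)) * ‖f‖ ^ 2 := fun f => by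
    rw [← tsum_mul_right]
    exact (hsum f).tsum_le_tsum (fun l => hab l f) (hcs.mul_right _)
  have hSs : IsSqSeminorm S := by
    refine ⟨fun f => tsum_nonneg fun l => mul_nonneg (ha0 l).le ((hΘs l).nonneg f),
      ⟨convex_univ, ?_⟩, fun t f => ?_⟩
    · intro f _ g _ s t hs ht hst
      simp only [hS, smul_eq_mul]
      rw [← tsum_mul_left, ← tsum_mul_left,
        ← ((hsum f).mul_left s).tsum_add ((hsum g).mul_left t)]
      refine (hsum _).tsum_le_tsum (fun l => ?_)
        (((hsum f).mul_left s).add ((hsum g).mul_left t))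
      simpa using ((hΘs l).const_mul (ha0 l).le).convexOn.2 (Set.mem_univ f) (Set.mem_univ g)
        hs ht hst
    · simp only [hS, (hΘs _).smul]
      rw [← tsum_mul_left]
      exact tsum_congr fun l => by ring
  have hSdef : ∀ l f g, a l * midpointDefect (Θ l) f g ≤ midpointDefect S f g := by
    intro l f g
    have hs := (((hsum f).hasSum.mul_left (1 / 2)).add ((hsum g).hasSum.mul_left (1 / 2))).sub
      (hsum ((1 / 2 : ℝ) • (f + g))).hasSum
    have := le_hasSum hs l fun j _ => by
      have := mul_nonneg (ha0 j).le ((hΘs j).midpointDefect_nonneg f g)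
      simp only [midpointDefect] at this
      linarith
    simp only [midpointDefect, hS]
    linarith
  have hΦ : IsSqSeminorm (fun f => ‖f‖ ^ 2 + S f) := IsSqSeminorm.norm_sq.add hSs
  refine ⟨hΦ.toSeminorm, ⟨1, √(1 + ∑' l, (c l : ℝ)), one_pos, ?_, fun f => ⟨?_, ?_⟩⟩, ?_⟩
  · have : 0 ≤ ∑' l, (c l : ℝ) := tsum_nonneg fun l => (c l).coe_nonneg
    positivity
  · rw [hΦ.toSeminorm_apply, one_mul]
    refine Real.le_sqrt_of_sq_le ?_
    linarith [hSs.nonneg f]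
  · rw [hΦ.toSeminorm_apply]
    refine Real.sqrt_le_iff.2 ⟨by positivity, ?_⟩
    have : 0 ≤ ∑' l, (c l : ℝ) := tsum_nonneg fun l => (c l).coe_nonneg
    rw [mul_pow, Real.sq_sqrt (by positivity)]
    linarith [hSB f]
  · intro f g hg
    simp only [hΦ.toSeminorm_sq] at hg
    have hgΘ : ∀ l, Tendsto (fun r => midpointDefect (Θ l) f (g r)) atTop (𝓝 0) := fun l =>
      tendsto_midpointDefect_of_le (hΘs l) (ha0 l) (fun r => by
        refine (hSdef l f (g r)).trans ?_
        have := IsSqSeminorm.norm_sq.midpointDefect_nonneg f (g r)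
        rw [midpointDefect_add]
        linarith) (Ψ := fun f => ‖f‖ ^ 2 + S f) hg
    have hlim := H f g fun l i₀ η hη hi₀ =>
      tendsto_midpointDefect_of_iSup (hχ l) (hbdd l) hη hi₀ (hgΘ l)
    have hle : ∀ u : E, hΦ.toSeminorm u ≤ √(1 + ∑' l, (c l : ℝ)) * ‖u‖ := fun u => by
      rw [hΦ.toSeminorm_apply]
      have : 0 ≤ ∑' l, (c l : ℝ) := tsum_nonneg fun l => (c l).coe_nonneg
      refine Real.sqrt_le_iff.2 ⟨by positivity, ?_⟩
      rw [mul_pow, Real.sq_sqrt (by positivity)]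
      linarith [hSB u]
    exact squeeze_zero (fun r => apply_nonneg _ _) (fun r => hle _)
      (by simpa using hlim.const_mul √(1 + ∑' l, (c l : ℝ)))

end SquareSeminorm

/-! ### Covers by isolated families -/

/-- A cover of `X` by a union of isolated families, indexed by `J`. The members of the `j`-th family
are the sets `mem j c`, and isolatedness is witnessed by open sets `nhd j c` that contain `mem j c`
and miss all other members of the same family. -/
structure IsolatedCover (X J ι : Type*) [TopologicalSpace X] where
  /-- the members of the families -/
  mem : J → ι → Set X
  /-- open neighbourhoods isolating the members -/
  nhd : J → ι → Set X
  isOpen_nhd : ∀ j c, IsOpen (nhd j c)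
  mem_subset_nhd : ∀ j c, mem j c ⊆ nhd j c
  disjoint_nhd_mem : ∀ j c c', c ≠ c' → Disjoint (nhd j c) (mem j c')
  exists_mem : ∀ x, ∃ j c, x ∈ mem j c

namespace IsolatedCover

variable {X J ι : Type*} [TopologicalSpace X] (𝒩 : IsolatedCover X J ι)

/-- The closed hull of the `j`-th family. -/
def hull (j : J) : Set X := closure (⋃ c, 𝒩.mem j c)

/-- The part of the closed hull of the `j`-th family that is covered by no isolating
neighbourhood. -/
def core (j : J) : Set X := 𝒩.hull j \ ⋃ c, 𝒩.nhd j c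

/-- The intersection of the cores of finitely many families. -/
def coreInter (s : Finset J) : Set X := ⋂ j ∈ s, 𝒩.core j

/-- The set attached to `(s, j)` which is to be avoided so that only finitely many of the pieces
`𝒩.piece (s, j) c` matter. -/
def boundary (p : Finset J × J) : Set X := 𝒩.core p.2 ∩ 𝒩.coreInter p.1

/-- For fixed `p = (s, j)`, the sets `𝒩.piece p c` are pairwise disjoint, relatively open in the
closed set `𝒩.hull j ∩ 𝒩.coreInter s`, and cover the complement of `𝒩.boundary p` in it. -/
def piece (p : Finset J × J) (c : ι) : Set X := 𝒩.hull p.2 ∩ 𝒩.nhd p.2 c ∩ 𝒩.coreInter p.1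

lemma isClosed_hull (j : J) : IsClosed (𝒩.hull j) := isClosed_closure

lemma isClosed_core (j : J) : IsClosed (𝒩.core j) :=
  (𝒩.isClosed_hull j).sdiff (isOpen_iUnion fun c => 𝒩.isOpen_nhd j c)

lemma isClosed_coreInter (s : Finset J) : IsClosed (𝒩.coreInter s) :=
  isClosed_biInter fun j _ => 𝒩.isClosed_core j

lemma isClosed_boundary (p : Finset J × J) : IsClosed (𝒩.boundary p) :=
  (𝒩.isClosed_core p.2).inter (𝒩.isClosed_coreInter p.1)

lemma mem_hull {j : J} {c : ι} {x : X} (hx : x ∈ 𝒩.mem j c) : x ∈ 𝒩.hull j :=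
  subset_closure (Set.mem_iUnion.2 ⟨c, hx⟩)

lemma hull_inter_nhd_subset (j : J) (c : ι) : 𝒩.hull j ∩ 𝒩.nhd j c ⊆ closure (𝒩.mem j c) := by
  rintro x ⟨hx, hxc⟩
  rw [mem_closure_iff]
  intro V hV hxV
  obtain ⟨y, ⟨hyV, hyc⟩, hy⟩ :=
    mem_closure_iff.1 hx (V ∩ 𝒩.nhd j c) (hV.inter (𝒩.isOpen_nhd j c)) ⟨hxV, hxc⟩
  obtain ⟨c', hc'⟩ := Set.mem_iUnion.1 hy
  by_cases h : c = c'
  · subst h; exact ⟨y, hyV, hc'⟩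
  · exact absurd hc' (Set.disjoint_left.1 (𝒩.disjoint_nhd_mem j c c' h) hyc)

lemma piece_subset (p : Finset J × J) (c : ι) : 𝒩.piece p c ⊆ closure (𝒩.mem p.2 c) :=
  fun _ hx => 𝒩.hull_inter_nhd_subset p.2 c hx.1

lemma eq_of_mem_nhd {j : J} {c c' : ι} {x : X} (hx : x ∈ 𝒩.hull j) (hc : x ∈ 𝒩.nhd j c)
    (hc' : x ∈ 𝒩.nhd j c') : c = c' := by
  by_contra h
  obtain ⟨y, hy, hy'⟩ := mem_closure_iff.1 (𝒩.hull_inter_nhd_subset j c ⟨hx, hc⟩)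
    (𝒩.nhd j c') (𝒩.isOpen_nhd j c') hc'
  exact Set.disjoint_left.1 (𝒩.disjoint_nhd_mem j c' c (Ne.symm h)) hy hy'

variable [CompactSpace X]

/-- A closed set that avoids the boundary meets only finitely many pieces. -/
lemma finite_piece_inter (p : Finset J × J) {H : Set X} (hH : IsClosed H)
    (hHp : ∀ x ∈ H, x ∉ 𝒩.boundary p) : {c | (𝒩.piece p c ∩ H).Nonempty}.Finite := by
  have hcpt : IsCompact (H ∩ (𝒩.hull p.2 ∩ 𝒩.coreInter p.1)) :=
    (hH.inter ((𝒩.isClosed_hull _).inter (𝒩.isClosed_coreInter _))).isCompact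
  obtain ⟨t, ht⟩ := hcpt.elim_finite_subcover (fun c => 𝒩.nhd p.2 c) (𝒩.isOpen_nhd p.2)
    (by
      rintro x ⟨hxH, hxF, hxS⟩
      by_contra hx
      exact hHp x hxH ⟨⟨hxF, hx⟩, hxS⟩)
  refine t.finite_toSet.subset ?_
  rintro c ⟨x, ⟨⟨hxF, hxc⟩, hxS⟩, hxH⟩
  obtain ⟨c', hc't, hc'⟩ := Set.mem_iUnion₂.1 (ht ⟨hxH, hxF, hxS⟩)
  rw [𝒩.eq_of_mem_nhd hxF hxc hc']
  exact hc't

/-- Every nonempty closed set `H` avoids the boundary, but meets a piece, for a suitable `p`.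

Take a maximal set `T` of indices for which `H` meets the intersection of the cores, and a point
`x` of that intersection. Some family `j` covers `x`; then `x` is not in the core of `j`, so
by maximality and compactness `H ∩ 𝒩.coreInter s` misses that core for a finite `s ⊆ T`. -/
lemma exists_piece_inter {H : Set X} (hH : IsClosed H) (hne : H.Nonempty) :
    ∃ p, (∀ x ∈ H, x ∉ 𝒩.boundary p) ∧ ∃ c, (𝒩.piece p c ∩ H).Nonempty := by
  classical
  obtain ⟨T, hT⟩ : ∃ T : Set J, Maximal (fun T => (H ∩ ⋂ j ∈ T, 𝒩.core j).Nonempty) T := by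
    obtain ⟨T, -, hT⟩ := zorn_subset_nonempty
      {T : Set J | (H ∩ ⋂ j ∈ T, 𝒩.core j).Nonempty} (fun C hC hchain hCne => by
        refine ⟨⋃₀ C, ?_, fun s hs => Set.subset_sUnion_of_mem hs⟩
        have : Nonempty C := hCne.to_subtype
        have key : (⋂ T : C, H ∩ ⋂ j ∈ T.1, 𝒩.core j).Nonempty := by
          refine IsCompact.nonempty_iInter_of_directed_nonempty_isCompact_isClosed _ ?_
            (fun T => hC T.2) (fun T => ?_) (fun T => ?_)
          · intro S T
            rcases hchain.total S.2 T.2 with h | h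
            · exact ⟨T, Set.inter_subset_inter_right _ (Set.biInter_subset_biInter_left h),
                subset_rfl⟩
            · exact ⟨S, subset_rfl,
                Set.inter_subset_inter_right _ (Set.biInter_subset_biInter_left h)⟩
          · exact (hH.inter (isClosed_biInter fun j _ => 𝒩.isClosed_core j)).isCompact
          · exact hH.inter (isClosed_biInter fun j _ => 𝒩.isClosed_core j)
        obtain ⟨x, hx⟩ := key
        rw [Set.mem_iInter] at hx
        refine ⟨x, (hx (Classical.arbitrary C)).1, ?_⟩
        rw [Set.mem_iInter₂]
        rintro j ⟨S, hS, hjS⟩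
        exact Set.mem_iInter₂.1 (hx ⟨S, hS⟩).2 j hjS)
      ∅ (by simpa using hne)
    exact ⟨T, hT⟩
  obtain ⟨x, hxH, hxT⟩ := hT.prop
  obtain ⟨j, c, hxc⟩ := 𝒩.exists_mem x
  have hxn : x ∈ 𝒩.nhd j c := 𝒩.mem_subset_nhd j c hxc
  have hxj : x ∉ 𝒩.core j := fun h => h.2 (Set.mem_iUnion.2 ⟨c, hxn⟩)
  have hempty : (H ∩ 𝒩.core j) ∩ ⋂ i : T, 𝒩.core i = ∅ := by
    by_contra hcon
    obtain ⟨y, ⟨hyH, hyj⟩, hyT⟩ := Set.nonempty_iff_ne_empty.2 hcon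
    rw [Set.mem_iInter] at hyT
    have hins : (H ∩ ⋂ i ∈ insert j T, 𝒩.core i).Nonempty := by
      refine ⟨y, hyH, Set.mem_iInter₂.2 ?_⟩
      rintro i (rfl | hi)
      · exact hyj
      · exact hyT ⟨i, hi⟩
    have hjT : j ∈ T := hT.le_of_ge hins (Set.subset_insert j T) (Set.mem_insert j T)
    exact hxj (Set.mem_iInter₂.1 hxT j hjT)
  obtain ⟨u, hu⟩ := (hH.inter (𝒩.isClosed_core j)).isCompact.elim_finite_subfamily_closed
    (fun i : T => 𝒩.core i) (fun i => 𝒩.isClosed_core i) hempty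
  refine ⟨(u.image Subtype.val, j), ?_, c, x, ⟨⟨𝒩.mem_hull hxc, hxn⟩, ?_⟩, hxH⟩
  · rintro y hyH ⟨hyj, hyS⟩
    have : y ∈ (H ∩ 𝒩.core j) ∩ ⋂ i ∈ u, 𝒩.core i := by
      refine ⟨⟨hyH, hyj⟩, Set.mem_iInter₂.2 fun i hi => ?_⟩
      exact Set.mem_iInter₂.1 hyS i (Finset.mem_image_of_mem _ hi)
    rw [hu] at this
    exact this
  · refine Set.mem_iInter₂.2 fun i hi => ?_
    obtain ⟨i', -, rfl⟩ := Finset.mem_image.1 hi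
    exact Set.mem_iInter₂.1 hxT i' i'.2

end IsolatedCover

/-! ### Selecting finitely many pieces by a strict maximum -/

/-- The supremum of `g` on `Z`, for a nonnegative function `g`; it is `0` when `Z` is empty. -/
noncomputable def supOn {X : Type*} (Z : Set X) (g : X → ℝ) : ℝ := ⨆ z : Z, g z

section supOn

variable {X : Type*} {Z : Set X} {g : X → ℝ} {b : ℝ}

lemma supOn_nonneg (hg : ∀ x, 0 ≤ g x) : 0 ≤ supOn Z g := Real.iSup_nonneg fun z => hg z

lemma supOn_le (hb : 0 ≤ b) (h : ∀ z ∈ Z, g z ≤ b) : supOn Z g ≤ b :=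
  Real.iSup_le (fun z => h z z.2) hb

lemma le_supOn (hb : ∀ x, g x ≤ b) {z : X} (hz : z ∈ Z) : g z ≤ supOn Z g :=
  le_ciSup (f := fun z : Z => g z) ⟨b, by rintro _ ⟨y, rfl⟩; exact hb y⟩ ⟨z, hz⟩

end supOn

/-- The sum of the `#A` largest values is attained at a unique set of indices `A`, if the values on
`A` are at least `t` and the other values are at most `t - η`. -/
lemma sum_add_le_sum_of_card_eq {ι : Type*} {h : ι → ℝ} {t η : ℝ} (hη : 0 ≤ η) {A A' : Finset ι}
    (hA : ∀ c ∈ A, t ≤ h c) (hA' : ∀ c ∉ A, h c + η ≤ t) (hcard : A'.card = A.card)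
    (hne : A' ≠ A) : ∑ c ∈ A', h c + η ≤ ∑ c ∈ A, h c := by
  classical
  have h1 : ∑ c ∈ A' \ A, h c ≤ (A' \ A).card • (t - η) :=
    Finset.sum_le_card_nsmul _ _ _ fun c hc => by
      have := hA' c (Finset.mem_sdiff.1 hc).2
      linarith
  have h2 : (A \ A').card • t ≤ ∑ c ∈ A \ A', h c :=
    Finset.card_nsmul_le_sum _ _ _ fun c hc => hA c (Finset.mem_sdiff.1 hc).1
  have h3 : (A' \ A).card = (A \ A').card := Finset.card_sdiff_comm hcard
  have h4 : 1 ≤ (A \ A').card := by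
    rw [Nat.one_le_iff_ne_zero, Finset.card_ne_zero, Finset.sdiff_nonempty]
    intro hsub
    exact hne (Finset.eq_of_subset_of_card_le hsub hcard.le).symm
  have h5 := Finset.sum_inter_add_sum_sdiff A' A h
  have h6 := Finset.sum_inter_add_sum_sdiff A A' h
  rw [Finset.inter_comm] at h6
  rw [h3, nsmul_eq_mul] at h1
  rw [nsmul_eq_mul] at h2
  have h7 : (1 : ℝ) ≤ ((A \ A').card : ℝ) := by exact_mod_cast h4
  nlinarith

namespace IsolatedCover

variable {X J ι : Type*}

/-- A selection of pieces in finitely many stages, the latest stage first. A stage `(p, A, w)`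
selects the pieces `𝒩.piece p c` with `c ∈ A`; the number `w` is the weight given to the earlier
stages. -/
abbrev Selection (J ι : Type*) := List ((Finset J × J) × Finset ι × ℕ)

/-- The shape of a selection: all of its data except for the selected indices, of which only the
number is kept. There are only countably many shapes if `J` is countable. -/
def shape (i : Selection J ι) : List ((Finset J × J) × ℕ × ℕ) :=
  i.map fun s => (s.1, s.2.1.card, s.2.2)

/-- The union of the sets `O c` over all selected indices `c`. -/
def removed (O : ι → Set X) : Selection J ι → Set X
  | [] => ∅
  | s :: i => removed O i ∪ ⋃ c ∈ s.2.1, O c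

lemma removed_subset_biUnion (O : ι → Set X) : ∀ i : Selection J ι, ∃ A : Finset ι, removed O i ⊆ ⋃ c ∈ A, O c
  | [] => ⟨∅, by simp [removed]⟩
  | s :: i => by
    classical
    obtain ⟨A, hA⟩ := removed_subset_biUnion O i
    refine ⟨A ∪ s.2.1, ?_⟩
    rw [Finset.set_biUnion_union]
    exact Set.union_subset_union_left _ hA

variable [TopologicalSpace X] (𝒩 : IsolatedCover X J ι) (O : ι → Set X)

/-- The score of a selection `i` at `g`. In each stage, the suprema of `g` over the selected pieces,
without what was removed in earlier stages, are added up, and the total of the earlier stages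
is multiplied by the weight. -/
noncomputable def score : Selection J ι → (X → ℝ) → ℝ
  | [], _ => 0
  | s :: i, g => s.2.2 * score i g + ∑ c ∈ s.2.1, supOn (𝒩.piece s.1 c \ removed O i) g

/-- The selection `i` has the largest score at `g` among all selections of its shape, and the
others stay below by a fixed amount. -/
def IsStrictMax (i : Selection J ι) (g : X → ℝ) : Prop :=
  ∃ η : ℝ, 0 < η ∧ ∀ i', i' ≠ i → shape i' = shape i → 𝒩.score O i' g + η ≤ 𝒩.score O i g

variable {O}

lemma isOpen_removed (hO : ∀ c, IsOpen (O c)) : ∀ i : Selection J ι, IsOpen (removed O i)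
  | [] => isOpen_empty
  | _ :: i => (isOpen_removed hO i).union (isOpen_biUnion fun c _ => hO c)

lemma isStrictMax_nil (g : X → ℝ) : 𝒩.IsStrictMax O [] g :=
  ⟨1, one_pos, fun _ hne hs => absurd (List.map_eq_nil_iff.1 hs) hne⟩

/-- If the weight is large, a strictly maximal selection can be prolonged by a stage that is
strictly maximal for given earlier stages. -/
lemma IsStrictMax.cons {i : Selection J ι} {g : X → ℝ} (hi : 𝒩.IsStrictMax O i g) {b : ℝ}
    (hg0 : ∀ x, 0 ≤ g x) (hgb : ∀ x, g x ≤ b) (p : Finset J × J) {A : Finset ι} {t η : ℝ}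
    (hη : 0 < η)
    (hA : ∀ c ∈ A, t ≤ supOn (𝒩.piece p c \ removed O i) g)
    (hA' : ∀ c ∉ A, supOn (𝒩.piece p c \ removed O i) g + η ≤ t) :
    ∃ w, 𝒩.IsStrictMax O ((p, A, w) :: i) g := by
  obtain ⟨η₀, hη₀, hmax⟩ := hi
  obtain ⟨w, hw⟩ := exists_nat_ge ((A.card * |b| + 1) / η₀)
  rw [div_le_iff₀ hη₀] at hw
  refine ⟨w, min 1 η, by positivity, ?_⟩
  intro i' hne hs
  obtain _ | ⟨⟨p', A', w'⟩, j⟩ := i'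
  · simp [shape] at hs
  simp only [shape, List.map_cons, List.cons.injEq, Prod.mk.injEq] at hs
  obtain ⟨⟨rfl, hcard, rfl⟩, hs⟩ := hs
  simp only [score]
  by_cases hj : j = i
  · subst hj
    have hAA : A' ≠ A := fun h => hne (by rw [h])
    have := sum_add_le_sum_of_card_eq hη.le hA hA' hcard hAA
    linarith [min_le_right 1 η]
  · have h1 := hmax j hj hs
    have h2 : ∑ c ∈ A', supOn (𝒩.piece p' c \ removed O j) g ≤ A'.card • |b| :=
      Finset.sum_le_card_nsmul _ _ _ fun c _ =>
        supOn_le (abs_nonneg b) fun z _ => (hgb z).trans (le_abs_self b)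
    rw [nsmul_eq_mul, hcard] at h2
    have h3 : 0 ≤ ∑ c ∈ A, supOn (𝒩.piece p' c \ removed O i) g :=
      Finset.sum_nonneg fun c _ => supOn_nonneg hg0
    have h4 : (w' : ℝ) * (𝒩.score O j g + η₀) ≤ w' * 𝒩.score O i g :=
      mul_le_mul_of_nonneg_left h1 (Nat.cast_nonneg _)
    linarith [min_le_left 1 η]

variable [CompactSpace X]

/-- If `g < t'` on the boundary, then for `t > t'` the pieces on which the supremum of `g` is at
least `t` are finite in number, and the suprema over the others stay away from `t`. -/
lemma exists_finset_gap {C : Set X} (hC : IsClosed C) {g : X → ℝ} (hg : Continuous g)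
    (p : Finset J × J) {t' t : ℝ} (ht' : 0 < t')
    (ht : t' < t) (hb : ∀ z ∈ 𝒩.boundary p, z ∈ C → g z < t') :
    ∃ (A : Finset ι) (η : ℝ), 0 < η ∧ (∀ c ∈ A, t ≤ supOn (𝒩.piece p c ∩ C) g) ∧
      (∀ c ∉ A, supOn (𝒩.piece p c ∩ C) g + η ≤ t) := by
  classical
  have hfin := 𝒩.finite_piece_inter p (H := C ∩ {z | t' ≤ g z})
    (hC.inter (isClosed_le continuous_const hg))
    fun x hx hxp => (hb x hxp hx.1).not_ge hx.2
  set D := hfin.toFinset with hD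
  set h : ι → ℝ := fun c => supOn (𝒩.piece p c ∩ C) g with hh
  have hev : ∀ᶠ η in 𝓝[>] (0 : ℝ), ∀ c ∈ D.filter (fun c => h c < t), η ≤ t - h c := by
    rw [Filter.eventually_all_finset]
    intro c hc
    have := sub_pos.2 (Finset.mem_filter.1 hc).2
    exact Filter.mem_of_superset (Ioc_mem_nhdsGT this) fun η hη => hη.2
  obtain ⟨η, hη, hη0, hηt⟩ := (hev.and (Ioc_mem_nhdsGT (sub_pos.2 ht))).exists
  refine ⟨D.filter (fun c => t ≤ h c), η, hη0, fun c hc => (Finset.mem_filter.1 hc).2, ?_⟩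
  intro c hc
  change h c + η ≤ t
  by_cases hcD : c ∈ D
  · have hlt : h c < t := by
      by_contra hcon
      exact hc (Finset.mem_filter.2 ⟨hcD, not_lt.1 hcon⟩)
    linarith [hη c (Finset.mem_filter.2 ⟨hcD, hlt⟩)]
  · have : h c ≤ t' := supOn_le ht'.le fun z hz => by
      by_contra hcon
      refine hcD ?_
      rw [hD, Set.Finite.mem_toFinset]
      exact ⟨z, hz.1, hz.2, (not_le.1 hcon).le⟩
    linarith

lemma IsStrictMax.exists_extension (hO : ∀ c, IsOpen (O c)) {g : X → ℝ} (hg : Continuous g) {b : ℝ}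
    (hg0 : ∀ x, 0 ≤ g x) (hgb : ∀ x, g x ≤ b) {i : Selection J ι} (hi : 𝒩.IsStrictMax O i g)
    (p : Finset J × J) (t' t : ℝ) :
    ∃ j, 𝒩.IsStrictMax O j g ∧ removed O i ⊆ removed O j ∧
      (0 < t' → t' < t → (∀ z ∈ 𝒩.boundary p, z ∉ removed O i → g z < t') →
        ∀ c, ∀ z ∈ 𝒩.piece p c, z ∉ removed O i → t ≤ g z → O c ⊆ removed O j) := by
  by_cases h : 0 < t' ∧ t' < t ∧ ∀ z ∈ 𝒩.boundary p, z ∉ removed O i → g z < t'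
  · obtain ⟨ht', ht, hb⟩ := h
    obtain ⟨A, η, hη, hA, hA'⟩ :=
      𝒩.exists_finset_gap (isOpen_removed hO i).isClosed_compl hg p ht' ht hb
    obtain ⟨w, hw⟩ := hi.cons 𝒩 hg0 hgb p hη hA hA'
    refine ⟨_, hw, Set.subset_union_left, fun _ _ _ c z hz hzi htz => ?_⟩
    have hcA : c ∈ A := by
      by_contra hcon
      have h1 := hA' c hcon
      have h2 := le_supOn (Z := 𝒩.piece p c ∩ (removed O i)ᶜ) hgb ⟨hz, hzi⟩
      linarith
    exact (Set.subset_biUnion_of_mem (u := fun c => O c) hcA).trans Set.subset_union_right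
  · exact ⟨i, hi, subset_rfl, fun h1 h2 h3 => absurd ⟨h1, h2, h3⟩ h⟩

/-- For every `g` and `ε` there is a strictly maximal selection that removes all points where
`g ≥ ε`.

Selections are prolonged successively, going infinitely often through all `p` and all pairs of
rational thresholds. If the points outside of all removed sets included one with `g ≥ ε`, then
`exists_piece_inter`, applied to the set where `g` is maximal on this remainder, would give
a piece that is selected at some stage although it meets the remainder. -/
theorem exists_isStrictMax [Countable J] (hO : ∀ c, IsOpen (O c)) {g : X → ℝ} (hg : Continuous g)
    (hg0 : ∀ x, 0 ≤ g x) {ε : ℝ} (hε : 0 < ε)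
    (hgO : ∀ p c, ∀ z ∈ 𝒩.piece p c, ε ≤ g z → z ∈ O c) :
    ∃ i, 𝒩.IsStrictMax O i g ∧ ∀ z ∉ removed O i, g z < ε := by
  by_contra! hcon
  obtain ⟨z₀, -, -⟩ := hcon [] (𝒩.isStrictMax_nil g)
  have : Nonempty J := ⟨(𝒩.exists_mem z₀).choose⟩
  obtain ⟨b, hb⟩ := (isCompact_range hg).bddAbove
  have hgb : ∀ x, g x ≤ b := fun x => hb ⟨x, rfl⟩
  obtain ⟨e, he⟩ := exists_surjective_nat ((Finset J × J) × ℚ × ℚ)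
  choose! next hnext₁ hnext₂ hnext₃ using fun (i : Selection J ι) (p : Finset J × J) (t' t : ℝ)
    (hi : 𝒩.IsStrictMax O i g) => hi.exists_extension 𝒩 hO hg hg0 hgb p t' t
  -- The first component of `Nat.unpair` takes every value infinitely often.
  let code : ℕ → (Finset J × J) × ℚ × ℚ := fun s => e s.unpair.1
  let sel : ℕ → Selection J ι := fun s =>
    Nat.rec [] (fun s i => next i (code s).1 (code s).2.1 (code s).2.2) s
  have hsucc : ∀ s, sel (s + 1) = next (sel s) (code s).1 (code s).2.1 (code s).2.2 := fun _ => rfl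
  have hsel : ∀ s, 𝒩.IsStrictMax O (sel s) g := by
    intro s
    induction s with
    | zero => exact 𝒩.isStrictMax_nil g
    | succ s ih => rw [hsucc]; exact hnext₁ _ _ _ _ ih
  have hmono : Monotone fun s => removed O (sel s) :=
    monotone_nat_of_le_succ fun s => by
      simp only [hsucc]
      exact hnext₂ _ _ _ _ (hsel s)
  set C : ℕ → Set X := fun s => (removed O (sel s))ᶜ with hC
  have hCcl : ∀ s, IsClosed (C s) := fun s => (isOpen_removed hO _).isClosed_compl
  have hCanti : Antitone C := fun s r hsr => Set.compl_subset_compl.2 (hmono hsr)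
  -- The remainder contains a point where `g ≥ ε`.
  have hne : (⋂ s, C s ∩ {z | ε ≤ g z}).Nonempty := by
    refine IsCompact.nonempty_iInter_of_sequence_nonempty_isCompact_isClosed _ (fun s => ?_)
      (fun s => ?_) ?_ (fun s => ?_)
    · exact Set.inter_subset_inter_left _ (hCanti (Nat.le_succ s))
    · obtain ⟨z, hz, hz'⟩ := hcon (sel s) (hsel s)
      exact ⟨z, hz, hz'⟩
    · exact ((hCcl 0).inter (isClosed_le continuous_const hg)).isCompact
    · exact (hCcl s).inter (isClosed_le continuous_const hg)
  have hCinf : IsClosed (⋂ s, C s) := isClosed_iInter hCcl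
  obtain ⟨z₁, hz₁⟩ := hne
  rw [Set.mem_iInter] at hz₁
  obtain ⟨zm, hzm, hmax⟩ := hCinf.isCompact.exists_isMaxOn
    ⟨z₁, Set.mem_iInter.2 fun s => (hz₁ s).1⟩ hg.continuousOn
  set m := g zm with hm
  have hεm : ε ≤ m := (hz₁ 0).2.trans (hmax (Set.mem_iInter.2 fun s => (hz₁ s).1))
  obtain ⟨p, hp, c, z, hzp, hzC, hzm'⟩ := 𝒩.exists_piece_inter
    (hCinf.inter (isClosed_le (continuous_const (y := m)) hg)) ⟨zm, hzm, hm.le⟩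
  -- By compactness, `g` stays below `m` on the boundary minus the sets removed at some stage.
  obtain ⟨s₀, hs₀⟩ : ∃ s₀ : ℕ, ∀ x ∈ 𝒩.boundary p, x ∈ C s₀ → g x < m - 1 / (s₀ + 1) := by
    by_contra! hbad
    have : (⋂ s : ℕ, 𝒩.boundary p ∩ C s ∩ {x | m - 1 / ((s : ℝ) + 1) ≤ g x}).Nonempty := by
      refine IsCompact.nonempty_iInter_of_sequence_nonempty_isCompact_isClosed _ (fun s => ?_)
        (fun s => ?_) ?_ (fun s => ?_)
      · rintro x ⟨⟨h1, h2⟩, h3⟩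
        refine ⟨⟨h1, hCanti (Nat.le_succ s) h2⟩, le_trans (b := m - 1 / ((s + 1 : ℕ) + 1 : ℝ)) ?_ h3⟩
        have := Nat.one_div_le_one_div (α := ℝ) (Nat.le_succ s)
        push_cast at this ⊢
        linarith
      · obtain ⟨x, hx1, hx2, hx3⟩ := hbad s
        exact ⟨x, ⟨hx1, hx2⟩, hx3⟩
      · exact (((𝒩.isClosed_boundary p).inter (hCcl 0)).inter
          (isClosed_le continuous_const hg)).isCompact
      · exact ((𝒩.isClosed_boundary p).inter (hCcl s)).inter (isClosed_le continuous_const hg)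
    obtain ⟨x, hx⟩ := this
    rw [Set.mem_iInter] at hx
    refine hp x ⟨Set.mem_iInter.2 fun s => (hx s).1.2, ?_⟩ (hx 0).1.1
    have hlim : Tendsto (fun s : ℕ => m - 1 / ((s : ℝ) + 1)) atTop (𝓝 m) := by
      simpa using tendsto_one_div_add_atTop_nhds_zero_nat.const_sub m
    exact le_of_tendsto hlim (Eventually.of_forall fun s => (hx s).2)
  have hpos : (0 : ℝ) < 1 / (s₀ + 1) := by positivity
  obtain ⟨t', ht'1, ht'2⟩ := exists_rat_btwn
    (show max 0 (m - 1 / ((s₀ : ℝ) + 1)) < m from max_lt (hε.trans_le hεm) (by linarith))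
  obtain ⟨t, ht1, ht2⟩ := exists_rat_btwn ht'2
  obtain ⟨n, hn⟩ := he (p, t', t)
  have hcode : code (Nat.pair n s₀) = (p, t', t) := by simp [code, hn]
  have hle : s₀ ≤ Nat.pair n s₀ := Nat.right_le_pair n s₀
  have hsub := hnext₃ (sel (Nat.pair n s₀)) p t' t (hsel _)
    ((le_max_left _ _).trans_lt ht'1) ht1
    (fun x hx hxC => (hs₀ x hx (hCanti hle hxC)).trans ((le_max_right _ _).trans_lt ht'1))
    c z hzp (Set.mem_iInter.1 hzC _) (ht2.le.trans hzm')
  have hrem : z ∈ removed O (sel (Nat.pair n s₀ + 1)) := by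
    rw [hsucc, hcode]
    exact hsub (hgO p c z hzp (hεm.trans hzm'))
  exact Set.mem_iInter.1 hzC (Nat.pair n s₀ + 1) hrem

end IsolatedCover

/-! ### Isolated covers of Namioka–Phelps compacta -/

/-- Stone's construction: every metric space has, for each `δ > 0`, an open cover by subsets of
balls of radius `δ` that is a countable union of disjoint families. -/
lemma exists_open_cover_disjoint {M : Type*} [PseudoMetricSpace M] {δ : ℝ} (hδ : 0 < δ) :
    ∃ D : ℕ → M → Set M, (∀ m a, IsOpen (D m a)) ∧ (∀ m a, D m a ⊆ Metric.ball a δ) ∧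
      (∀ m a b, a ≠ b → Disjoint (D m a) (D m b)) ∧ ∀ x, ∃ m a, x ∈ D m a := by
  obtain ⟨r, hwo⟩ := exists_wellFoundedLT M
  let ctr : ℕ → M → Set M := fun m a =>
    {x | (∀ b, b < a → x ∉ Metric.ball b δ) ∧ Metric.ball x (3 * (1 / 2) ^ m) ⊆ Metric.ball a δ}
  have hpos : ∀ m : ℕ, (0 : ℝ) < (1 / 2) ^ m := fun m => by positivity
  have hlt : ∀ m a b, a < b → Disjoint (⋃ x ∈ ctr m a, Metric.ball x ((1 / 2) ^ m))
      (⋃ x ∈ ctr m b, Metric.ball x ((1 / 2) ^ m)) := by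
    intro m a b hab
    rw [Set.disjoint_left]
    intro z hza hzb
    obtain ⟨x, hx, hzx⟩ := Set.mem_iUnion₂.1 hza
    obtain ⟨y, hy, hzy⟩ := Set.mem_iUnion₂.1 hzb
    refine hy.1 a hab (hx.2 ?_)
    rw [Metric.mem_ball] at *
    have := dist_triangle_left y x z
    linarith [hpos m]
  refine ⟨fun m a => ⋃ x ∈ ctr m a, Metric.ball x ((1 / 2) ^ m), fun m a =>
    isOpen_biUnion fun _ _ => Metric.isOpen_ball, fun m a => ?_, fun m a b hab => ?_, fun x => ?_⟩
  · refine Set.iUnion₂_subset fun x hx => (Metric.ball_subset_ball ?_).trans hx.2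
    linarith [hpos m]
  · rcases lt_or_gt_of_ne hab with h | h
    · exact hlt m a b h
    · exact (hlt m b a h).symm
  · obtain ⟨a, ha, hmin⟩ := WellFounded.has_min (wellFounded_lt (α := M))
      {a | x ∈ Metric.ball a δ} ⟨x, Metric.mem_ball_self hδ⟩
    have ha' : 0 < δ - dist x a := sub_pos.2 ha
    obtain ⟨m, hm⟩ := exists_pow_lt_of_lt_one (show 0 < (δ - dist x a) / 3 by positivity)
      (show (1 / 2 : ℝ) < 1 by norm_num)
    refine ⟨m, a, Set.mem_iUnion₂.2 ⟨x, ⟨fun b hb hx => hmin b hx hb, ?_⟩,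
      Metric.mem_ball_self (hpos m)⟩⟩
    exact Metric.ball_subset_ball' (by linarith)

/-- In the topology generated by the open sets and countably many sets `B n`, every point of an open
set `D` has a neighbourhood `U ∩ ⋂ n ∈ s, B n ⊆ D`, with `U` open and `s` finite. -/
lemma exists_isOpen_inter_subset {K : Type*} [TopologicalSpace K] {B : ℕ → Set K} {D : Set K}
    (hD : IsOpen[TopologicalSpace.generateFrom ({U : Set K | IsOpen U} ∪ Set.range B)] D) :
    ∀ x ∈ D, ∃ (s : Finset ℕ) (U : Set K), IsOpen U ∧ x ∈ U ∧ x ∈ ⋂ n ∈ s, B n ∧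
      U ∩ ⋂ n ∈ s, B n ⊆ D := by
  classical
  induction hD with
  | basic D hD =>
    intro x hx
    rcases hD with hD | ⟨n, rfl⟩
    · exact ⟨∅, D, hD, hx, by simp, Set.inter_subset_left⟩
    · exact ⟨{n}, Set.univ, isOpen_univ, trivial, by simpa using hx, by simp⟩
  | univ => exact fun x _ => ⟨∅, Set.univ, isOpen_univ, trivial, by simp, Set.subset_univ _⟩
  | inter D D' _ _ ih ih' =>
    rintro x ⟨hx, hx'⟩
    obtain ⟨s, U, hU, hxU, hxs, hsub⟩ := ih x hx
    obtain ⟨s', U', hU', hxU', hxs', hsub'⟩ := ih' x hx'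
    have hinter : ⋂ n ∈ s ∪ s', B n = (⋂ n ∈ s, B n) ∩ ⋂ n ∈ s', B n := by
      ext; simp [or_imp, forall_and]
    refine ⟨s ∪ s', U ∩ U', hU.inter hU', ⟨hxU, hxU'⟩, ?_, ?_⟩
    · rw [hinter]; exact ⟨hxs, hxs'⟩
    · rw [hinter]
      rintro y ⟨⟨hy, hy'⟩, hys, hys'⟩
      exact ⟨hsub ⟨hy, hys⟩, hsub' ⟨hy', hys'⟩⟩
  | sUnion S _ ih =>
    rintro x ⟨D, hDS, hxD⟩
    obtain ⟨s, U, hU, hxU, hxs, hsub⟩ := ih D hDS x hxD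
    exact ⟨s, U, hU, hxU, hxs, hsub.trans (Set.subset_sUnion_of_mem hDS)⟩

/-- Property `P(d, T)` yields, for each `δ > 0`, a countable union of isolated families that
covers `K` by sets contained in balls of radius `δ`. -/
lemma PropertyP.exists_isolatedCover {K : Type*} {T : TopologicalSpace K} {d : MetricSpace K}
    (h : PropertyP d T) {δ : ℝ} (hδ : 0 < δ) :
    ∃ 𝒩 : IsolatedCover K (ℕ × Finset ℕ) K, ∀ j a, ∀ x ∈ 𝒩.mem j a, d.dist a x ≤ δ := by
  obtain ⟨-, B, hB⟩ := h
  obtain ⟨D, hDo, hDb, hDd, hDc⟩ := @exists_open_cover_disjoint K d.toPseudoMetricSpace δ hδ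
  let W : ℕ × Finset ℕ → K → Set K := fun j a =>
    ⋃₀ {U | IsOpen U ∧ U ∩ ⋂ n ∈ j.2, B n ⊆ D j.1 a}
  have hWD : ∀ j a, W j a ∩ ⋂ n ∈ j.2, B n ⊆ D j.1 a := by
    rintro j a x ⟨⟨U, ⟨-, hU⟩, hxU⟩, hx⟩
    exact hU ⟨hxU, hx⟩
  refine ⟨⟨fun j a => W j a ∩ ⋂ n ∈ j.2, B n, W, fun j a => isOpen_sUnion fun U hU => hU.1,
    fun j a => Set.inter_subset_left, fun j a b hab => ?_, fun x => ?_⟩, fun j a x hx => ?_⟩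
  · rw [Set.disjoint_left]
    rintro x hxa hxb
    exact Set.disjoint_left.1 (hDd j.1 a b hab) (hWD j a ⟨hxa, hxb.2⟩) (hWD j b hxb)
  · obtain ⟨m, a, hx⟩ := hDc x
    obtain ⟨s, U, hU, hxU, hxs, hsub⟩ := exists_isOpen_inter_subset (hB _ (hDo m a)) x hx
    exact ⟨(m, s), a, ⟨U, ⟨hU, hsub⟩, hxU⟩, hxs⟩
  · have := hDb j.1 a (hWD j a hx)
    rw [Metric.mem_ball'] at this
    exact this.le

namespace IsolatedCover

variable {X J ι X' J' ι' : Type*} [TopologicalSpace X] [TopologicalSpace X']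

/-- The product of two isolated covers. -/
def prod (𝒩 : IsolatedCover X J ι) (𝒩' : IsolatedCover X' J' ι') :
    IsolatedCover (X × X') (J × J') (ι × ι') where
  mem j c := 𝒩.mem j.1 c.1 ×ˢ 𝒩'.mem j.2 c.2
  nhd j c := 𝒩.nhd j.1 c.1 ×ˢ 𝒩'.nhd j.2 c.2
  isOpen_nhd j c := (𝒩.isOpen_nhd _ _).prod (𝒩'.isOpen_nhd _ _)
  mem_subset_nhd j c := Set.prod_mono (𝒩.mem_subset_nhd _ _) (𝒩'.mem_subset_nhd _ _)
  disjoint_nhd_mem j c c' h := by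
    rw [Set.disjoint_prod]
    by_cases h1 : c.1 = c'.1
    · exact Or.inr (𝒩'.disjoint_nhd_mem _ _ _ fun h2 => h (Prod.ext h1 h2))
    · exact Or.inl (𝒩.disjoint_nhd_mem _ _ _ h1)
  exists_mem x := by
    obtain ⟨j, c, h⟩ := 𝒩.exists_mem x.1
    obtain ⟨j', c', h'⟩ := 𝒩'.exists_mem x.2
    exact ⟨(j, j'), (c, c'), h, h'⟩

end IsolatedCover

namespace IsLSCMetric

variable {K : Type*} [T : TopologicalSpace K] {d : MetricSpace K}

lemma isClosed_closedBall (h : IsLSCMetric T d) (a : K) (δ : ℝ) :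
    IsClosed {x | d.dist a x ≤ δ} :=
  (LowerSemicontinuous.isClosed_preimage h δ).preimage (f := fun x => (a, x)) (by fun_prop)

lemma t2Space (h : IsLSCMetric T d) : T2Space K := by
  rw [t2_iff_isClosed_diagonal]
  convert LowerSemicontinuous.isClosed_preimage h 0 using 1
  ext ⟨x, y⟩
  have h1 : d.dist x y ≤ 0 ↔ x = y := @dist_le_zero K d x y
  exact h1.symm

/-- Continuous functions on a compact space are uniformly continuous for every lower semicontinuous
metric: `d` attains a positive minimum on the compact set where `|f x - f y| ≥ ε`. -/
lemma exists_forall_dist_le [CompactSpace K] (h : IsLSCMetric T d) {f : K → ℝ} (hf : Continuous f)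
    {ε : ℝ} (hε : 0 < ε) : ∃ δ : ℝ, 0 < δ ∧ ∀ x y, d.dist x y ≤ δ → |f x - f y| < ε := by
  have hZ : IsCompact {z : K × K | ε ≤ |f z.1 - f z.2|} :=
    (isClosed_le continuous_const (by fun_prop)).isCompact
  rcases Set.eq_empty_or_nonempty {z : K × K | ε ≤ |f z.1 - f z.2|} with hemp | hne
  · refine ⟨1, one_pos, fun x y _ => ?_⟩
    by_contra hcon
    have : (x, y) ∈ {z : K × K | ε ≤ |f z.1 - f z.2|} := not_lt.1 hcon
    rw [hemp] at this
    exact this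
  · obtain ⟨z, hz, hmin⟩ := LowerSemicontinuousOn.exists_isMinOn hne hZ
      (LowerSemicontinuous.lowerSemicontinuousOn h _)
    have hpos : 0 < d.dist z.1 z.2 := by
      refine (@dist_pos K d _ _).2 fun heq => ?_
      have : ε ≤ |f z.1 - f z.2| := hz
      rw [heq, sub_self, abs_zero] at this
      linarith
    refine ⟨d.dist z.1 z.2 / 2, by positivity, fun x y hxy => ?_⟩
    by_contra hcon
    have : d.dist z.1 z.2 ≤ d.dist x y := hmin (show (x, y) ∈ _ from not_lt.1 hcon)
    linarith

end IsLSCMetric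

/-! ### Functions determined by finitely many pieces -/

/-- The squared oscillation of `f` between the two coordinates of a point of `K × K`. -/
def sqDiff {K : Type*} (f : K → ℝ) (z : K × K) : ℝ := (f z.1 - f z.2) ^ 2

lemma sqDiff_nonneg {K : Type*} (f : K → ℝ) (z : K × K) : 0 ≤ sqDiff f z := sq_nonneg _

/-- For finitely many pairs of disjoint sets `V c`, `V' c`, finitely many points represent all points
up to the relation of not being separated by one of these pairs. -/
lemma exists_finset_forall_notMem_prod {K ι : Type*} (A : Finset ι) {V V' : ι → Set K}
    (hV : ∀ c, Disjoint (V c) (V' c)) :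
    ∃ P : Finset K, ∀ x, ∃ y ∈ P, ∀ c ∈ A, (x, y) ∉ V c ×ˢ V' c := by
  classical
  let τ : K → Finset ι := fun x => A.filter fun c => x ∈ V c
  obtain ⟨S, -, hS⟩ := Set.exists_subset_bijOn Set.univ τ
  have hfin : S.Finite := by
    refine Set.Finite.of_finite_image ?_ hS.injOn
    refine (A.powerset.finite_toSet).subset ?_
    rintro _ ⟨x, -, rfl⟩
    exact Finset.mem_coe.2 (Finset.mem_powerset.2 (Finset.filter_subset _ _))
  refine ⟨hfin.toFinset, fun x => ?_⟩
  obtain ⟨y, hyS, hxy⟩ := hS.surjOn ⟨x, Set.mem_univ x, rfl⟩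
  refine ⟨y, hfin.mem_toFinset.2 hyS, fun c hc hcon => ?_⟩
  have hx : c ∈ τ x := Finset.mem_filter.2 ⟨hc, hcon.1⟩
  rw [← hxy] at hx
  exact Set.disjoint_left.1 (hV c) (Finset.mem_filter.1 hx).2 hcon.2

section Forms

variable {K : Type*} [TopologicalSpace K] [CompactSpace K]

lemma sqDiff_le (f : C(K, ℝ)) (z : K × K) : sqDiff f z ≤ 4 * ‖f‖ ^ 2 := by
  have h1 := f.norm_coe_le_norm z.1
  have h2 := f.norm_coe_le_norm z.2
  rw [Real.norm_eq_abs, abs_le] at h1 h2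
  have : |f z.1 - f z.2| ≤ 2 * ‖f‖ := abs_le.2 ⟨by linarith, by linarith⟩
  calc sqDiff f z = |f z.1 - f z.2| ^ 2 := (sq_abs _).symm
    _ ≤ (2 * ‖f‖) ^ 2 := by gcongr
    _ = _ := by ring

lemma isSqSeminorm_supOn_sqDiff (Z : Set (K × K)) :
    IsSqSeminorm (fun f : C(K, ℝ) => supOn Z (sqDiff f)) := by
  refine IsSqSeminorm.iSup (fun z => ?_) fun f => ⟨4 * ‖f‖ ^ 2, ?_⟩
  · exact IsSqSeminorm.linear_sq
      ((ContinuousMap.evalCLM ℝ z.1.1 - ContinuousMap.evalCLM ℝ z.1.2 : C(K, ℝ) →L[ℝ] ℝ) :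
        C(K, ℝ) →ₗ[ℝ] ℝ)
  · rintro _ ⟨z, rfl⟩
    exact sqDiff_le f z

lemma supOn_sqDiff_le (Z : Set (K × K)) (f : C(K, ℝ)) : supOn Z (sqDiff f) ≤ 4 * ‖f‖ ^ 2 :=
  supOn_le (by positivity) fun z _ => sqDiff_le f z

lemma isSqSeminorm_eval (x : K) : IsSqSeminorm (fun f : C(K, ℝ) => f x ^ 2) :=
  IsSqSeminorm.linear_sq ((ContinuousMap.evalCLM ℝ x : C(K, ℝ) →L[ℝ] ℝ) : C(K, ℝ) →ₗ[ℝ] ℝ)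

lemma sq_sub_eq_midpointDefect_eval (f g : C(K, ℝ)) (x : K) :
    (f x - g x) ^ 2 = 4 * midpointDefect (fun u : C(K, ℝ) => u x ^ 2) f g := by
  simp only [midpointDefect, ContinuousMap.smul_apply, ContinuousMap.add_apply, smul_eq_mul]
  ring

/-- The mean of the squared values of `f` on a finite set; it is `0` on the empty set. -/
noncomputable def meanSq (P : Finset K) (f : C(K, ℝ)) : ℝ := (P.card : ℝ)⁻¹ * ∑ x ∈ P, f x ^ 2

lemma isSqSeminorm_meanSq (P : Finset K) : IsSqSeminorm (meanSq P) :=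
  (IsSqSeminorm.sum P fun x _ => isSqSeminorm_eval x).const_mul (by positivity)

lemma meanSq_le (P : Finset K) (f : C(K, ℝ)) : meanSq P f ≤ ‖f‖ ^ 2 := by
  have h : ∑ x ∈ P, f x ^ 2 ≤ P.card • ‖f‖ ^ 2 := Finset.sum_le_card_nsmul _ _ _ fun x _ => by
    rw [← sq_abs, ← Real.norm_eq_abs]
    exact pow_le_pow_left₀ (norm_nonneg _) (f.norm_coe_le_norm x) 2
  rw [nsmul_eq_mul] at h
  unfold meanSq
  rcases P.eq_empty_or_nonempty with rfl | hP
  · simp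
  · have : (0 : ℝ) < P.card := by exact_mod_cast hP.card_pos
    rw [inv_mul_le_iff₀ this]
    exact h

lemma tendsto_eval_of_meanSq {P : Finset K} {f : C(K, ℝ)} {g : ℕ → C(K, ℝ)}
    (h : Tendsto (fun r => midpointDefect (meanSq P) f (g r)) atTop (𝓝 0)) {x : K} (hx : x ∈ P) :
    Tendsto (fun r => (f x - g r x) ^ 2) atTop (𝓝 0) := by
  classical
  have hpos : (0 : ℝ) < P.card := by exact_mod_cast Finset.card_pos.2 ⟨x, hx⟩
  have hev := tendsto_midpointDefect_of_le (isSqSeminorm_eval x) (inv_pos.2 hpos) (fun r => by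
    have hrest := (IsSqSeminorm.sum (P.erase x)
      fun y _ => isSqSeminorm_eval y).midpointDefect_nonneg f (g r)
    have hsplit : meanSq P = fun u : C(K, ℝ) =>
        (P.card : ℝ)⁻¹ * (u x ^ 2 + ∑ y ∈ P.erase x, u y ^ 2) := by
      funext u
      rw [meanSq, Finset.add_sum_erase P (fun y => u y ^ 2) hx]
    rw [hsplit, midpointDefect_const_mul, midpointDefect_add]
    gcongr
    linarith) h
  simp only [sq_sub_eq_midpointDefect_eval]
  simpa using hev.const_mul 4

namespace IsolatedCover

variable {J ι : Type*} (𝒩 : IsolatedCover (K × K) J ι) (O : ι → Set (K × K))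

lemma isSqSeminorm_score : ∀ i : Selection J ι,
    IsSqSeminorm (fun f : C(K, ℝ) => 𝒩.score O i (sqDiff f))
  | [] => IsSqSeminorm.zero
  | _ :: i => ((isSqSeminorm_score i).const_mul (Nat.cast_nonneg _)).add
      (IsSqSeminorm.sum _ fun _ _ => isSqSeminorm_supOn_sqDiff _)

/-- A bound for the scores of all selections of a given shape on the unit ball. -/
noncomputable def scoreBound : List ((Finset J × J) × ℕ × ℕ) → ℝ
  | [] => 0
  | s :: l => s.2.2 * scoreBound l + s.2.1 * 4

lemma scoreBound_nonneg : ∀ l : List ((Finset J × J) × ℕ × ℕ), 0 ≤ scoreBound l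
  | [] => le_rfl
  | s :: l => by
    have := scoreBound_nonneg l
    simp only [scoreBound]
    positivity

lemma score_le (f : C(K, ℝ)) : ∀ i : Selection J ι,
    𝒩.score O i (sqDiff f) ≤ scoreBound (shape i) * ‖f‖ ^ 2
  | [] => by simp [score, scoreBound, shape]
  | s :: i => by
    have h1 : ∑ c ∈ s.2.1, supOn (𝒩.piece s.1 c \ removed O i) (sqDiff f)
        ≤ s.2.1.card • (4 * ‖f‖ ^ 2) :=
      Finset.sum_le_card_nsmul _ _ _ fun c _ => supOn_sqDiff_le _ f
    rw [nsmul_eq_mul] at h1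
    have h2 := mul_le_mul_of_nonneg_left (score_le f i) (Nat.cast_nonneg (α := ℝ) s.2.2)
    simp only [shape, score, scoreBound, List.map_cons] at h2 ⊢
    linarith

/-- The square of the seminorm attached to a selection `i`, a finite set `P` and a number `k`. The
score is there to single out a selection adapted to `f`; the other two terms then control `f` up
to its oscillation off the removed set. -/
noncomputable def selectionForm (k : ℕ) (P : Finset K) (i : Selection J ι) (f : C(K, ℝ)) : ℝ :=
  k * 𝒩.score O i (sqDiff f) + (supOn (removed O i)ᶜ (sqDiff f) + meanSq P f)

lemma isSqSeminorm_selectionForm (k : ℕ) (P : Finset K) (i : Selection J ι) :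
    IsSqSeminorm (𝒩.selectionForm O k P i) :=
  ((𝒩.isSqSeminorm_score O i).const_mul (Nat.cast_nonneg _)).add
    ((isSqSeminorm_supOn_sqDiff _).add (isSqSeminorm_meanSq P))

lemma selectionForm_le (k : ℕ) (P : Finset K) (i : Selection J ι) (f : C(K, ℝ)) :
    𝒩.selectionForm O k P i f ≤ (k * scoreBound (shape i) + 5) * ‖f‖ ^ 2 := by
  have h1 := mul_le_mul_of_nonneg_left (𝒩.score_le O f i) (Nat.cast_nonneg (α := ℝ) k)
  have h2 := supOn_sqDiff_le (removed O i)ᶜ f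
  have h3 := meanSq_le P f
  unfold selectionForm
  linarith

variable {𝒩 O}

/-- A large factor `k` turns a strict maximum of the score into one of the whole form. -/
lemma IsStrictMax.exists_selectionForm {i₀ : Selection J ι} {f : C(K, ℝ)}
    (h : 𝒩.IsStrictMax O i₀ (sqDiff f)) (P : Selection J ι → Finset K) :
    ∃ k : ℕ, ∀ i, i ≠ i₀ → shape i = shape i₀ →
      𝒩.selectionForm O k (P i) i f + 1 ≤ 𝒩.selectionForm O k (P i₀) i₀ f := by
  obtain ⟨η, hη, hmax⟩ := h
  obtain ⟨k, hk⟩ := exists_nat_ge ((5 * ‖f‖ ^ 2 + 1) / η)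
  rw [div_le_iff₀ hη] at hk
  refine ⟨k, fun i hi hs => ?_⟩
  have h1 := mul_le_mul_of_nonneg_left (hmax i hi hs) (Nat.cast_nonneg (α := ℝ) k)
  have h2 := supOn_sqDiff_le (removed O i)ᶜ f
  have h3 := meanSq_le (P i) f
  have h4 := (isSqSeminorm_supOn_sqDiff (removed O i₀)ᶜ).nonneg f
  have h5 := (isSqSeminorm_meanSq (P i₀)).nonneg f
  unfold selectionForm
  linarith

/-- If `f` oscillates by at most `ε` off the removed set of `i`, and the points of `P` represent all
points of `K`, then a vanishing midpoint defect of the selection form makes `g r` eventually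
uniformly `4 * ε`-close to `f`. -/
lemma eventually_norm_sub_le {k : ℕ} {P : Finset K} {i : Selection J ι} {f : C(K, ℝ)}
    {g : ℕ → C(K, ℝ)} {ε : ℝ} (hε : 0 < ε)
    (hg : Tendsto (fun r => midpointDefect (𝒩.selectionForm O k P i) f (g r)) atTop (𝓝 0))
    (hf : ∀ z ∉ removed O i, sqDiff f z < ε ^ 2) (hP : ∀ x, ∃ y ∈ P, (x, y) ∉ removed O i) :
    ∀ᶠ r in atTop, ‖f - g r‖ ≤ 4 * ε := by
  have hsplit : ∀ r, midpointDefect (𝒩.selectionForm O k P i) f (g r) =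
      k * midpointDefect (fun f : C(K, ℝ) => 𝒩.score O i (sqDiff f)) f (g r) +
        (midpointDefect (fun f : C(K, ℝ) => supOn (removed O i)ᶜ (sqDiff f)) f (g r) +
          midpointDefect (meanSq P) f (g r)) := fun r => by
    simp only [midpointDefect, selectionForm]; ring
  have h1 : ∀ r, 0 ≤ k * midpointDefect (fun f : C(K, ℝ) => 𝒩.score O i (sqDiff f)) f (g r) :=
    fun r => mul_nonneg (Nat.cast_nonneg _) ((𝒩.isSqSeminorm_score O i).midpointDefect_nonneg _ _)
  have h2 := fun r => (isSqSeminorm_supOn_sqDiff (removed O i)ᶜ).midpointDefect_nonneg f (g r)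
  have h3 := fun r => (isSqSeminorm_meanSq P).midpointDefect_nonneg f (g r)
  have hosc := (isSqSeminorm_supOn_sqDiff (removed O i)ᶜ).tendsto_sqrt
    (tendsto_midpointDefect_of_le (isSqSeminorm_supOn_sqDiff (removed O i)ᶜ) one_pos
      (fun r => by linarith [hsplit r, h1 r, h2 r, h3 r]) hg)
  have hmean := tendsto_midpointDefect_of_le (isSqSeminorm_meanSq P) one_pos
      (fun r => by linarith [hsplit r, h1 r, h2 r, h3 r]) hg
  have hsup : √(supOn (removed O i)ᶜ (sqDiff f)) < 2 * ε := by
    have : √(supOn (removed O i)ᶜ (sqDiff f)) ≤ ε :=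
      (Real.sqrt_le_left hε.le).2 (supOn_le (sq_nonneg ε) fun z hz => (hf z hz).le)
    linarith
  have hev : ∀ᶠ r in atTop, ∀ y ∈ P, (f y - g r y) ^ 2 < ε ^ 2 := by
    rw [Filter.eventually_all_finset]
    exact fun y hy => (tendsto_eval_of_meanSq hmean hy).eventually (gt_mem_nhds (by positivity))
  filter_upwards [hev, hosc.eventually (gt_mem_nhds hsup)] with r hr hr'
  rw [ContinuousMap.norm_le _ (by positivity)]
  intro x
  obtain ⟨y, hy, hxy⟩ := hP x
  have e1 : |f x - f y| < ε := abs_lt_of_sq_lt_sq (hf _ hxy) hε.le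
  have e2 : |f y - g r y| < ε := abs_lt_of_sq_lt_sq (hr y hy) hε.le
  have e3 : |g r x - g r y| < 2 * ε := by
    refine abs_lt_of_sq_lt_sq ?_ (by positivity)
    have := le_supOn (sqDiff_le (g r)) (show (x, y) ∈ (removed O i)ᶜ from hxy)
    exact lt_of_le_of_lt this ((Real.sqrt_lt' (by positivity)).1 hr')
  rw [abs_lt] at e1 e2 e3
  rw [ContinuousMap.sub_apply, Real.norm_eq_abs, abs_le]
  constructor <;> linarith

end IsolatedCover

end Forms

/-! ### The renorming -/

/-- For a lower semicontinuous metric, all pairs of closed balls of radius `δ` with centres further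
than `2 * δ` apart can be separated by open sets. -/
lemma IsLSCMetric.exists_separation {K : Type*} [T : TopologicalSpace K] [CompactSpace K]
    {d : MetricSpace K} (h : IsLSCMetric T d) (δ : ℝ) :
    ∃ V V' : K × K → Set K, (∀ c, IsOpen (V c)) ∧ (∀ c, IsOpen (V' c)) ∧
      (∀ c, Disjoint (V c) (V' c)) ∧ ∀ c : K × K, 2 * δ < d.dist c.1 c.2 →
        ∀ x y, d.dist c.1 x ≤ δ → d.dist c.2 y ≤ δ → x ∈ V c ∧ y ∈ V' c := by
  have : T2Space K := h.t2Space
  have key : ∀ c : K × K, ∃ V V' : Set K, IsOpen V ∧ IsOpen V' ∧ Disjoint V V' ∧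
      (2 * δ < d.dist c.1 c.2 → ∀ x y, d.dist c.1 x ≤ δ → d.dist c.2 y ≤ δ → x ∈ V ∧ y ∈ V') := by
    intro c
    by_cases hc : 2 * δ < d.dist c.1 c.2
    · obtain ⟨V, V', hV, hV', hsub, hsub', hdisj⟩ := normal_separation
        (h.isClosed_closedBall c.1 δ) (h.isClosed_closedBall c.2 δ) (by
          rw [Set.disjoint_left]
          intro x (hx : d.dist c.1 x ≤ δ) (hx' : d.dist c.2 x ≤ δ)
          have : d.dist c.1 c.2 ≤ d.dist c.1 x + d.dist c.2 x := @dist_triangle_right K _ c.1 c.2 x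
          linarith)
      exact ⟨V, V', hV, hV', hdisj, fun _ x y hx hy => ⟨hsub hx, hsub' hy⟩⟩
    · exact ⟨∅, ∅, isOpen_empty, isOpen_empty, Set.disjoint_empty _, fun h => absurd h hc⟩
  choose V V' h1 h2 h3 h4 using key
  exact ⟨V, V', h1, h2, h3, h4⟩

theorem theoremB {K : Type*} [TopologicalSpace K] [CompactSpace K]
    (hK : IsNamiokaPhelpsCompact K) :
    ∃ p : Seminorm ℝ C(K, ℝ), IsEquivalentNorm p ∧ IsLUR p := by
  obtain ⟨-, d, hlsc, hP⟩ := hK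
  have hpos : ∀ q : ℕ, (0 : ℝ) < 1 / ((q : ℝ) + 1) := fun q => by positivity
  choose 𝒩 h𝒩 using fun q : ℕ => hP.exists_isolatedCover (hpos q)
  choose V V' hV hV' hdisj hsep using fun q : ℕ => hlsc.exists_separation (1 / ((q : ℝ) + 1))
  let 𝒬 := fun q => (𝒩 q).prod (𝒩 q)
  let O : ℕ → K × K → Set (K × K) := fun q c => V q c ×ˢ V' q c
  have hO : ∀ q c, IsOpen (O q c) := fun q c => (hV q c).prod (hV' q c)
  have hrep : ∀ (q : ℕ) (i : IsolatedCover.Selection _ (K × K)), ∃ P : Finset K,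
      ∀ x, ∃ y ∈ P, (x, y) ∉ IsolatedCover.removed (J := (ℕ × Finset ℕ) × ℕ × Finset ℕ) (O q) i := by
    intro q i
    obtain ⟨A, hA⟩ := IsolatedCover.removed_subset_biUnion (O q) i
    obtain ⟨P, hP⟩ := exists_finset_forall_notMem_prod A (hdisj q)
    refine ⟨P, fun x => ?_⟩
    obtain ⟨y, hy, hxy⟩ := hP x
    refine ⟨y, hy, fun hcon => ?_⟩
    obtain ⟨c, hc, hcon'⟩ := Set.mem_iUnion₂.1 (hA hcon)
    exact hxy c hc hcon'
  choose P hPrep using hrep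
  refine exists_isLUR_of_strict_max
    (Λ := ℕ × ℕ × List ((Finset ((ℕ × Finset ℕ) × ℕ × Finset ℕ) × (ℕ × Finset ℕ) × ℕ × Finset ℕ)
      × ℕ × ℕ))
    (I := fun l => {i : IsolatedCover.Selection ((ℕ × Finset ℕ) × ℕ × Finset ℕ) (K × K) //
      IsolatedCover.shape i = l.2.2})
    (fun l i => (𝒬 l.1).selectionForm (O l.1) l.2.1 (P l.1 i) i)
    (fun l => l.2.1 * IsolatedCover.scoreBound l.2.2 + 5)
    (fun l => by have := IsolatedCover.scoreBound_nonneg l.2.2; positivity)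
    (fun l i => IsolatedCover.isSqSeminorm_selectionForm _ _ _ _ _)
    (fun l i f => by
      have := (𝒬 l.1).selectionForm_le (O l.1) l.2.1 (P l.1 i) i f
      rw [i.2] at this
      exact this) ?_
  intro f g H
  rw [← tendsto_zero_iff_norm_tendsto_zero, Metric.tendsto_atTop']
  intro ε' hε'
  obtain ⟨ε, hε, hεε'⟩ : ∃ ε : ℝ, 0 < ε ∧ 4 * ε < ε' := ⟨ε' / 8, by positivity, by linarith⟩
  obtain ⟨δ, hδ, hfδ⟩ := hlsc.exists_forall_dist_le f.continuous hε
  obtain ⟨q, hq⟩ := exists_nat_one_div_lt (show 0 < δ / 4 by positivity)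
  -- Distinct values of `f` force distant points, so `O q` covers the pieces that matter.
  have hgO : ∀ p c, ∀ z ∈ (𝒬 q).piece p c, ε ^ 2 ≤ sqDiff f z → z ∈ O q c := by
    intro p c z hz hfz
    have hz' : z ∈ closure ((𝒩 q).mem p.2.1 c.1 ×ˢ (𝒩 q).mem p.2.2 c.2) :=
      (𝒬 q).piece_subset p c hz
    rw [closure_prod_eq] at hz'
    have hz1 : d.dist c.1 z.1 ≤ 1 / ((q : ℝ) + 1) :=
      closure_minimal (fun x hx => h𝒩 q _ _ x hx) (hlsc.isClosed_closedBall _ _) hz'.1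
    have hz2 : d.dist c.2 z.2 ≤ 1 / ((q : ℝ) + 1) :=
      closure_minimal (fun x hx => h𝒩 q _ _ x hx) (hlsc.isClosed_closedBall _ _) hz'.2
    refine hsep q c ?_ z.1 z.2 hz1 hz2
    by_contra hcon
    have h1 : d.dist z.1 z.2 ≤ d.dist c.1 z.1 + d.dist c.1 c.2 + d.dist c.2 z.2 := by
      have := @dist_triangle4 K _ z.1 c.1 c.2 z.2
      rw [@dist_comm K _ z.1 c.1] at this
      exact this
    have h2 := hfδ z.1 z.2 (by linarith)
    rw [← abs_of_pos hε] at h2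
    exact absurd (sq_lt_sq.2 h2) (not_lt.2 hfz)
  obtain ⟨i, hi, hosc⟩ := (𝒬 q).exists_isStrictMax (hO q)
    (show Continuous (sqDiff f) by unfold sqDiff; fun_prop) (sqDiff_nonneg f)
    (show 0 < ε ^ 2 by positivity) hgO
  obtain ⟨k, hk⟩ := hi.exists_selectionForm (P q)
  have hdef := H (q, k, IsolatedCover.shape i) ⟨i, rfl⟩ 1 one_pos fun j hj =>
    hk j (fun h => hj (Subtype.ext h)) j.2
  have hev := IsolatedCover.eventually_norm_sub_le hε hdef hosc (hPrep q i)
  obtain ⟨N, hN⟩ := eventually_atTop.1 hev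
  exact ⟨N, fun r hr => by
    rw [dist_zero_right]
    exact (hN r hr.le).trans_lt hεε'⟩
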